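/- All graphs are finite and simple. An integer partition of a positive integer $n$ is a list of positive integers $a_1\le\dots\le a_k$ with $a_1+\dots+a_k=n$. A graph $G=(V,E)$ on $n\ge 1$ vertices is \emph{recursively partitionable} (RP) if $G\simeq K_1$, or if $G$ is connected and for every integer partition $a_1,\dots,a_k$ of $n$ with $k\ge 2$ there is a partition $\{A_1,\dots,A_k\}$ of $V$ with $|A_i|=a_i$ such that every induced subgraph $G[A_i]$ is RP. For a positive integer $k$ and non-negative integers $b_1,\dots,b_k$, the \emph{balloon} $B(b_1,\dots,b_k)$ consists of two non-adjacent vertices $u,v$ and $k$ disjoint paths $P_1,\dots,P_k$, where $P_i$ has $b_i$ vertices, and (if $b_i\ge 1$) the first vertex of $P_i$ is adjacent to $u$ and the last vertex of $P_i$ is adjacent to $v$. Let $c(H)$ denote the number of connected components of a graph $H$. Let $G=(V,E)$ be a graph. (1) If $G$ has a spanning tree that is RP, then $c(G-S)\le |S|+2$ for every $S\subseteq V$. (2) If $G$ has a spanning subgraph that is isomorphic to a balloon and is RP, then $c(G-S)\le |S|+4$ for every $S\subseteq V$. -/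

import Mathlib

universe u

/-- `a₁ ≤ ⋯ ≤ a_k` is an integer partition of `n` into `k` positive parts. -/
def IsIntegerPartition (n : ℕ) {k : ℕ} (a : Fin k → ℕ) : Prop :=
  (∀ i, 0 < a i) ∧ Monotone a ∧ ∑ i, a i = n

/-- `A₁, …, A_k` is an `(a₁, …, a_k)`-partition of the vertex set `V`: the `A i` are pairwise
disjoint, cover `V`, and `|A i| = a i`. -/
def IsVertexPartition {V : Type u} {k : ℕ} (a : Fin k → ℕ) (A : Fin k → Set V) : Prop :=
  Pairwise (fun i j => Disjoint (A i) (A j)) ∧ (⋃ i, A i) = Set.univ ∧ ∀ i, (A i).ncard = a i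

theorem IsIntegerPartition.lt {n k : ℕ} {a : Fin k → ℕ} (h : IsIntegerPartition n a)
    (hk : 2 ≤ k) (i : Fin k) : a i < n := by
  obtain ⟨hpos, -, rfl⟩ := h
  obtain ⟨j, hj⟩ : ∃ j : Fin k, j ≠ i := by
    have : Nontrivial (Fin k) := Fin.nontrivial_iff_two_le.2 hk
    exact exists_ne i
  exact Finset.single_lt_sum hj (Finset.mem_univ i) (Finset.mem_univ j) (hpos j)
    (fun _ _ _ => Nat.zero_le _)

namespace SimpleGraph

/-- A finite graph `G` of order `n` is recursively partitionable (RP) if it has exactly one vertex,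
or it is connected and, for every integer partition `a₁, …, a_k` of `n`, there is an
`(a₁, …, a_k)`-partition `A₁, …, A_k` of the vertex set such that every `G[A i]` is RP.
The recursion runs over partitions into `k ≥ 2` parts: the only vertex partition with one part is
the whole vertex set, for which the condition reads "`G` is RP" and says nothing. -/
def IsRP {V : Type u} [Finite V] (G : SimpleGraph V) : Prop :=
  Nat.card V = 1 ∨
    (G.Connected ∧
      ∀ (k : ℕ) (_hk : 2 ≤ k) (a : Fin k → ℕ) (_ha : IsIntegerPartition (Nat.card V) a),
        ∃ (A : Fin k → Set V) (_hA : IsVertexPartition a A), ∀ i, IsRP (G.induce (A i)))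
termination_by Nat.card V
decreasing_by
  have h1 : Nat.card (A i) = a i := _hA.2.2 i
  have h2 := _ha.lt _hk i
  omega

/-- The number `c(G)` of connected components of `G`. -/
noncomputable def numComponents {V : Type u} (G : SimpleGraph V) : ℕ :=
  Nat.card G.ConnectedComponent

/-- The graph `G - S`, obtained by deleting the vertices in `S`. -/
abbrev minusVerts {V : Type u} (G : SimpleGraph V) (S : Set V) : SimpleGraph (Sᶜ : Set V) :=
  G.induce Sᶜ

/-- The balloon graph `B(b₁, …, b_k)`. The vertices `Sum.inl false` and `Sum.inl true` are the two
non-adjacent vertices `u` and `v`; the vertices `Sum.inr ⟨i, 0⟩, …, Sum.inr ⟨i, b i - 1⟩` form the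
path `P i`, in this order. The first vertex of `P i` is adjacent to `u`, the last one to `v`.
(A path with `b i = 0` has no vertices and contributes nothing.) -/
def balloon {k : ℕ} (b : Fin k → ℕ) : SimpleGraph (Bool ⊕ (Σ i : Fin k, Fin (b i))) :=
  SimpleGraph.fromRel fun x y =>
    match x, y with
    | Sum.inr p, Sum.inr q => p.1 = q.1 ∧ (p.2 : ℕ) + 1 = (q.2 : ℕ)
    | Sum.inl false, Sum.inr p => (p.2 : ℕ) = 0
    | Sum.inl true, Sum.inr p => (p.2 : ℕ) + 1 = b p.1
    | _, _ => False

/-- `H` is (isomorphic to) a balloon graph `B(b₁, …, b_k)` with `k ≥ 1` and `b i ≥ 0`. -/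
def IsBalloon {V : Type u} (H : SimpleGraph V) : Prop :=
  ∃ (k : ℕ) (b : Fin k → ℕ), 0 < k ∧ Nonempty (H ≃g balloon b)

end SimpleGraph

/-!
Let `G` be RP and `S ≠ ∅`. If `G - S` had more than `3|S|` components, then by induction a cut of
`G` into two RP parts could not separate `S`, so one of the parts would be a component of `G - S`.
Hence for every `l ≤ n/2` some component would have `l` or `n - l` vertices, which is too much for
the `n` vertices available. So `c(G - S) ≤ 3|S|`. Deleting a vertex of degree at most two increases
the number of components by at most one; if all but `t` vertices have degree at most two, deleting
the vertices of `S` among those `t` first gives `c(G - S) ≤ |S| + 2t`.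

A balloon has `t = 2`. An RP tree has `t = 1`: if `x` and `y` had degree at least three, take two
branches at `x` avoiding `y` and two branches at `y` avoiding `x`. In a minimal RP graph with such
branches, a cut leaves one of the four branches as a part, or has a part that contains `x` or `y`
together with its two branches. The sizes of the branches cannot allow this for all cuts.
-/

open SimpleGraph

namespace RPGraph

variable {V : Type*} {G H : SimpleGraph V} {S : Set V}

theorem mem_of_reachable {P : Set V} (hP : ∀ ⦃v w⦄, G.Adj v w → v ∈ P → w ∈ P) {a b : V}
    (hab : G.Reachable a b) (ha : a ∈ P) : b ∈ P := by
  obtain ⟨p⟩ := hab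
  induction p with
  | nil => exact ha
  | cons hadj _ ih => exact ih (hP hadj ha)

theorem ncard_preimage_val (A S : Set V) :
    (Subtype.val ⁻¹' S : Set A).ncard = (A ∩ S).ncard := by
  rw [← Set.ncard_image_of_injective _ Subtype.val_injective, Subtype.image_preimage_coe]

/-! ### Counting components -/

theorem numComponents_le_one (h : G.Preconnected) : G.numComponents ≤ 1 :=
  have := h.subsingleton_connectedComponent
  Finite.card_le_one_iff_subsingleton.2 this

theorem numComponents_minusVerts_anti [Finite V] (hle : H ≤ G) (S : Set V) :
    (G.minusVerts S).numComponents ≤ (H.minusVerts S).numComponents :=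
  have hle' : H.minusVerts S ≤ G.minusVerts S := fun _ _ hadj => hle hadj
  Nat.card_le_card_of_surjective _ (ConnectedComponent.surjective_map_ofLE hle')

theorem sum_ncard_supp [Finite V] [Fintype G.ConnectedComponent] :
    ∑ c : G.ConnectedComponent, c.supp.ncard = Nat.card V := by
  rw [← finsum_eq_sum_of_fintype, ← Set.ncard_iUnion_of_finite (fun _ => Set.toFinite _)
    G.pairwise_disjoint_supp_connectedComponent, G.iUnion_connectedComponentSupp, Set.ncard_univ]

theorem mem_image_supp_of_reachable {w : V}
    {c : (G.minusVerts (insert w S)).ConnectedComponent} (hc : ∀ v ∈ c.supp, ¬G.Adj w v)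
    {a b : ↥Sᶜ} (hab : (G.minusVerts S).Reachable a b) (ha : (a : V) ∈ Subtype.val '' c.supp) :
    (b : V) ∈ Subtype.val '' c.supp := by
  refine mem_of_reachable (P := {v : ↥Sᶜ | (v : V) ∈ Subtype.val '' c.supp}) ?_ hab ha
  rintro u ⟨v, hvS⟩ hadj ⟨u', hu', huu'⟩
  have hadj' : G.Adj u' v := huu' ▸ hadj
  have hvw : v ≠ w := fun hvw => hc u' hu' (hvw ▸ hadj'.symm)
  exact ⟨⟨v, by simpa [hvw] using hvS⟩, c.mem_supp_of_adj_mem_supp hu' hadj', rfl⟩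

theorem numComponents_minusVerts_insert_add_one_le [Finite V] {w : V} (hw : w ∉ S) :
    (G.minusVerts (insert w S)).numComponents + 1 ≤
      (G.minusVerts S).numComponents + (G.neighborSet w).ncard := by
  have hle : (insert w S)ᶜ ⊆ Sᶜ := Set.compl_subset_compl.2 (Set.subset_insert w S)
  let merge : (G.minusVerts (insert w S)).ConnectedComponent →
      (G.minusVerts S).ConnectedComponent := ConnectedComponent.map (G.induceHomOfLE hle).toHom
  let touching : Set (G.minusVerts (insert w S)).ConnectedComponent :=
    connectedComponentMk _ '' (Subtype.val ⁻¹' G.neighborSet w)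
  have touching_le : touching.ncard ≤ (G.neighborSet w).ncard := by
    refine (Set.ncard_image_le (Set.toFinite _)).trans ?_
    rw [ncard_preimage_val]
    exact Set.ncard_le_ncard Set.inter_subset_right
  have not_adj {c} (hc : c ∈ touchingᶜ) : ∀ v ∈ c.supp, ¬G.Adj w v :=
    fun v hv hadj => hc ⟨v, hadj, hv⟩
  have merge_injOn : Set.InjOn merge touchingᶜ := by
    intro c hc d _ hcd
    induction c using ConnectedComponent.ind with | h a
    induction d using ConnectedComponent.ind with | h b
    obtain ⟨b', hb', hbb'⟩ := mem_image_supp_of_reachable (not_adj hc)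
      (ConnectedComponent.exact hcd) ⟨a, rfl, rfl⟩
    obtain rfl : b' = b := Subtype.ext hbb'
    exact hb'.symm
  have notMem_image : connectedComponentMk _ ⟨w, hw⟩ ∉ merge '' touchingᶜ := by
    rintro ⟨c, hc, hcw⟩
    induction c using ConnectedComponent.ind with | h a
    obtain ⟨b, -, hbw⟩ := mem_image_supp_of_reachable (not_adj hc)
      (ConnectedComponent.exact hcw) ⟨a, rfl, rfl⟩
    exact b.2 (Or.inl hbw)
  have compl_lt : touchingᶜ.ncard + 1 ≤ (G.minusVerts S).numComponents := by
    rw [← merge_injOn.ncard_image, ← Set.ncard_insert_of_notMem notMem_image]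
    exact Set.ncard_le_card _
  have := Set.ncard_add_ncard_compl touching
  rw [numComponents]
  omega

theorem numComponents_minusVerts_union_le [Finite V] (S : Set V) {D : Set V}
    (hD : ∀ w ∈ D, (G.neighborSet w).ncard ≤ 2) :
    (G.minusVerts (S ∪ D)).numComponents ≤ (G.minusVerts S).numComponents + D.ncard := by
  induction D, D.toFinite using Set.Finite.induction_on with
  | empty => rw [Set.union_empty, Set.ncard_empty, add_zero]
  | @insert w D hw hfin ih =>
    rw [Set.union_insert, Set.ncard_insert_of_notMem hw hfin]
    have hD' := ih fun v hv => hD v (Set.mem_insert_of_mem w hv)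
    by_cases hwS : w ∈ S ∪ D
    · rw [Set.insert_eq_of_mem hwS]
      omega
    · have := numComponents_minusVerts_insert_add_one_le (G := G) hwS
      have := hD w (Set.mem_insert w D)
      omega

theorem ncard_components_meeting_le [Finite V] (A S : Set V) :
    {c : (G.minusVerts S).ConnectedComponent | ∃ v ∈ c.supp, (v : V) ∈ A}.ncard ≤
      ((G.induce A).minusVerts (Subtype.val ⁻¹' S)).numComponents := by
  let inclusion : (G.induce A).minusVerts (Subtype.val ⁻¹' S) →g G.minusVerts S :=
    ⟨fun v => ⟨v.1, v.2⟩, fun hadj => hadj⟩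
  rw [numComponents, ← Set.ncard_univ]
  refine (Set.ncard_le_ncard ?_).trans
    (Set.ncard_image_le (f := ConnectedComponent.map inclusion) (Set.toFinite _))
  rintro _ ⟨v, rfl, hvA⟩
  exact ⟨connectedComponentMk _ ⟨⟨v, hvA⟩, v.2⟩, trivial, rfl⟩

theorem numComponents_minusVerts_le_add [Finite V] (L S : Set V) :
    (G.minusVerts S).numComponents ≤
      ((G.induce L).minusVerts (Subtype.val ⁻¹' S)).numComponents +
        ((G.induce Lᶜ).minusVerts (Subtype.val ⁻¹' S)).numComponents := by
  refine le_trans ?_ (add_le_add (ncard_components_meeting_le L S)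
    (ncard_components_meeting_le Lᶜ S))
  refine le_trans ?_ (Set.ncard_union_le _ _)
  rw [numComponents, ← Set.ncard_univ]
  refine Set.ncard_le_ncard fun c _ => ?_
  obtain ⟨v, hv⟩ := c.nonempty_supp
  exact (em ((v : V) ∈ L)).imp (fun hvL => ⟨v, hv, hvL⟩) (fun hvL => ⟨v, hv, hvL⟩)

/-- If no component of `G - S` were contained in `L`, then each would meet `Lᶜ`. -/
theorem exists_ncard_supp_eq [Finite V] {L : Set V} (hL : (G.induce L).Preconnected)
    (hLS : Disjoint L S)
    (hlt : ((G.induce Lᶜ).minusVerts (Subtype.val ⁻¹' S)).numComponents <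
      (G.minusVerts S).numComponents) :
    ∃ c : (G.minusVerts S).ConnectedComponent, c.supp.ncard = L.ncard := by
  obtain ⟨c, hc⟩ : ∃ c : (G.minusVerts S).ConnectedComponent, ∀ v ∈ c.supp, (v : V) ∈ L := by
    by_contra! hmeet
    refine hlt.not_ge (le_trans ?_ (ncard_components_meeting_le Lᶜ S))
    rw [numComponents, ← Set.ncard_univ]
    exact Set.ncard_le_ncard fun c _ => hmeet c
  obtain ⟨a, ha⟩ := c.nonempty_supp
  let inclusion : G.induce L →g G.minusVerts S :=
    ⟨fun v => ⟨v, Set.disjoint_left.1 hLS v.2⟩, fun hadj => hadj⟩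
  have hcL : Subtype.val '' c.supp = L := by
    refine Set.Subset.antisymm (Set.image_subset_iff.2 hc) fun v hv => ?_
    refine ⟨inclusion ⟨v, hv⟩, ?_, rfl⟩
    rw [ConnectedComponent.mem_supp_iff] at ha ⊢
    rw [← ha]
    exact ConnectedComponent.sound ((hL ⟨v, hv⟩ ⟨a, hc a ha⟩).map inclusion)
  exact ⟨c, by rw [← hcL, Set.ncard_image_of_injective _ Subtype.val_injective]⟩

/-- The cut cannot separate `S`, since otherwise the bounds for the two parts add up. -/
theorem exists_ncard_supp_eq_or_eq_compl [Finite V] {L : Set V} {m : ℕ}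
    (hL : (G.induce L).Preconnected) (hLc : (G.induce Lᶜ).Preconnected) (hS : S.Nonempty)
    (hlt : m * S.ncard < (G.minusVerts S).numComponents)
    (hL_le : ¬Disjoint L S →
      ((G.induce L).minusVerts (Subtype.val ⁻¹' S)).numComponents ≤ m * (L ∩ S).ncard)
    (hLc_le : ¬Disjoint Lᶜ S →
      ((G.induce Lᶜ).minusVerts (Subtype.val ⁻¹' S)).numComponents ≤ m * (Lᶜ ∩ S).ncard) :
    ∃ c : (G.minusVerts S).ConnectedComponent,
      c.supp.ncard = L.ncard ∨ c.supp.ncard = Lᶜ.ncard := by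
  by_cases hLS : Disjoint L S
  · have hsub : S ⊆ Lᶜ := hLS.subset_compl_left
    have hle := hLc_le fun hdis => hS.ne_empty (hdis.eq_bot_of_ge hsub)
    rw [Set.inter_eq_right.2 hsub] at hle
    obtain ⟨c, hc⟩ := exists_ncard_supp_eq hL hLS (hle.trans_lt hlt)
    exact ⟨c, .inl hc⟩
  by_cases hLcS : Disjoint Lᶜ S
  · have hle := hL_le hLS
    rw [Set.inter_eq_right.2 (Set.disjoint_compl_left_iff_subset.1 hLcS)] at hle
    obtain ⟨c, hc⟩ := exists_ncard_supp_eq hLc hLcS (by rw [compl_compl]; exact hle.trans_lt hlt)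
    exact ⟨c, .inr hc⟩
  refine absurd ?_ hlt.not_ge
  calc (G.minusVerts S).numComponents
      ≤ m * (L ∩ S).ncard + m * (Lᶜ ∩ S).ncard :=
        (numComponents_minusVerts_le_add L S).trans (add_le_add (hL_le hLS) (hLc_le hLcS))
    _ = m * S.ncard := by
        rw [← mul_add, Set.inter_comm, Set.inter_comm Lᶜ, ← Set.sdiff_eq,
          Set.ncard_inter_add_ncard_sdiff_eq_ncard]

/-! ### Recursively partitionable graphs -/

theorem connected_of_isRP [Finite V] (h : G.IsRP) : G.Connected := by
  rw [IsRP] at h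
  rcases h with hone | ⟨hconn, -⟩
  · obtain ⟨_, _⟩ := Nat.card_eq_one_iff_unique.1 hone
    exact .of_subsingleton
  · exact hconn

theorem exists_isVertexPartition_of_isRP [Finite V] (h : G.IsRP) {k : ℕ} (hk : 2 ≤ k)
    {a : Fin k → ℕ} (ha : IsIntegerPartition (Nat.card V) a) :
    ∃ A : Fin k → Set V, IsVertexPartition a A ∧ ∀ i, (G.induce (A i)).IsRP := by
  rw [IsRP] at h
  rcases h with hone | ⟨-, hpart⟩
  · have := ha.lt hk ⟨0, by omega⟩
    have := ha.1 ⟨0, by omega⟩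
    omega
  · obtain ⟨A, hA, hRP⟩ := hpart k hk a ha
    exact ⟨A, hA, hRP⟩

theorem exists_cut_of_isRP [Finite V] (h : G.IsRP) {l : ℕ} (hl : 0 < l) (hlV : l < Nat.card V) :
    ∃ L : Set V, L.ncard = l ∧ (G.induce L).IsRP ∧ (G.induce Lᶜ).IsRP := by
  wlog hle : 2 * l ≤ Nat.card V generalizing l
  · obtain ⟨L, hL, hLRP, hLcRP⟩ := this (l := Nat.card V - l) (by omega) (by omega) (by omega)
    have := Set.ncard_add_ncard_compl L
    exact ⟨Lᶜ, by omega, hLcRP, by rwa [compl_compl]⟩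
  have hpart : IsIntegerPartition (Nat.card V) ![l, Nat.card V - l] := by
    refine ⟨by simp [Fin.forall_fin_two, hl, hlV], ?_, by simp [hlV.le]⟩
    exact Fin.monotone_iff_le_succ.2 fun i => by
      obtain rfl := Subsingleton.elim i 0
      change l ≤ Nat.card V - l
      omega
  obtain ⟨A, ⟨hdis, hunion, hcard⟩, hRP⟩ := exists_isVertexPartition_of_isRP h le_rfl hpart
  have hcompl : (A 0)ᶜ = A 1 := by
    refine IsCompl.compl_eq ⟨hdis zero_ne_one, codisjoint_iff_le_sup.2 ?_⟩
    rw [Set.top_eq_univ, ← hunion]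
    exact Set.iUnion_subset (Fin.forall_fin_two.2 ⟨le_sup_left, le_sup_right⟩)
  exact ⟨A 0, hcard 0, hRP 0, hcompl ▸ hRP 1⟩

theorem card_add_le_four_of_forall_exists_size {ι : Type*} [Fintype ι] {size : ι → ℕ} {n s : ℕ}
    (hpos : ∀ c, 0 < size c) (hsum : ∑ c, size c + s = n)
    (hsize : ∀ l, 0 < l → 2 * l ≤ n → ∃ c, size c = l ∨ size c + l = n) :
    Fintype.card ι + s ≤ 4 := by
  obtain ⟨m, hm⟩ : ∃ m, m = n / 2 := ⟨_, rfl⟩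
  choose g hg using fun i : Fin m => hsize (i + 1) (by omega) (by omega)
  have hinj : Function.Injective g := fun i j hij => by
    have hi := hg i
    have hj := hg j
    rw [hij] at hi
    omega
  have hsum_excess : ∑ c, (size c - 1) + Fintype.card ι = ∑ c, size c := by
    rw [Fintype.card_eq_sum_ones, ← Finset.sum_add_distrib]
    exact Finset.sum_congr rfl fun c _ => Nat.sub_add_cancel (hpos c)
  -- Distinct `l` are realised by distinct indices, so the total excess over 1 is quadratic in `n`.
  have hexcess : ∑ i ∈ Finset.range m, i ≤ ∑ c, (size c - 1) :=
    calc ∑ i ∈ Finset.range m, i = ∑ i : Fin m, (i : ℕ) := Finset.sum_range _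
      _ ≤ ∑ i : Fin m, (size (g i) - 1) := Finset.sum_le_sum fun i _ => by have := hg i; omega
      _ = ∑ c ∈ Finset.univ.map ⟨g, hinj⟩, (size c - 1) := by
        rw [Finset.sum_map, Function.Embedding.coeFn_mk]
      _ ≤ ∑ c, (size c - 1) := Finset.sum_le_sum_of_subset (Finset.subset_univ _)
  have hgauss := Finset.sum_range_id_mul_two m
  rcases m with _ | m
  · omega
  simp only [Nat.add_sub_cancel] at hgauss
  have : 2 * (Fintype.card ι + s) + (m + 1) * m ≤ 4 * m + 6 := by omega
  zify at this ⊢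
  nlinarith [mul_self_nonneg ((m : ℤ) - 1), mul_self_nonneg ((m : ℤ) - 2)]

theorem numComponents_minusVerts_le_three_mul_of_isRP [Finite V] (h : G.IsRP) (hS : S.Nonempty) :
    (G.minusVerts S).numComponents ≤ 3 * S.ncard := by
  induction hn : Nat.card V using Nat.strong_induction_on generalizing V with | _ n ih
  subst hn
  by_contra! hlt
  have hpart {A : Set V} (hA : (G.induce A).IsRP) (hAV : A.ncard < Nat.card V)
      (hAS : ¬Disjoint A S) :
      ((G.induce A).minusVerts (Subtype.val ⁻¹' S)).numComponents ≤ 3 * (A ∩ S).ncard := by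
    rw [← ncard_preimage_val]
    exact ih _ hAV hA (Subtype.preimage_coe_nonempty.2 (Set.not_disjoint_iff_nonempty_inter.1 hAS))
      rfl
  have hsize (l : ℕ) (hl : 0 < l) (hlV : 2 * l ≤ Nat.card V) :
      ∃ c : (G.minusVerts S).ConnectedComponent,
        c.supp.ncard = l ∨ c.supp.ncard + l = Nat.card V := by
    obtain ⟨L, rfl, hL, hLc⟩ := exists_cut_of_isRP h hl (by omega)
    have hcard := Set.ncard_add_ncard_compl L
    obtain ⟨c, hc⟩ := exists_ncard_supp_eq_or_eq_compl (connected_of_isRP hL).preconnected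
      (connected_of_isRP hLc).preconnected hS hlt (hpart hL (by omega)) (hpart hLc (by omega))
    exact ⟨c, by omega⟩
  have := Fintype.ofFinite (G.minusVerts S).ConnectedComponent
  have hfour := card_add_le_four_of_forall_exists_size
    (fun c => (Set.ncard_pos).2 c.nonempty_supp)
    (by rw [sum_ncard_supp, Nat.card_coe_set_eq, add_comm, Set.ncard_add_ncard_compl]) hsize
  rw [← Nat.card_eq_fintype_card] at hfour
  rw [numComponents] at hlt
  have := (Set.ncard_pos).2 hS
  omega

theorem numComponents_minusVerts_le_of_isRP [Finite V] (h : H.IsRP) (hle : H ≤ G) {U : Set V}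
    {t : ℕ} (ht : 1 ≤ t) (hU : U.ncard ≤ t) (hdeg : ∀ w ∉ U, (H.neighborSet w).ncard ≤ 2)
    (S : Set V) : (G.minusVerts S).numComponents ≤ S.ncard + 2 * t := by
  have hinter : (H.minusVerts (S ∩ U)).numComponents ≤ (S ∩ U).ncard + 2 * t := by
    rcases (S ∩ U).eq_empty_or_nonempty with hempty | hne
    · have hconn : (H.minusVerts ∅).Preconnected := by
        rw [minusVerts, Set.compl_empty]
        exact H.induceUnivIso.symm.preconnected_iff.1 (connected_of_isRP h).preconnected
      have := numComponents_le_one hconn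
      rw [hempty]
      omega
    · have := numComponents_minusVerts_le_three_mul_of_isRP h hne
      have := Set.ncard_le_ncard (Set.inter_subset_right (s := S) (t := U))
      omega
  calc (G.minusVerts S).numComponents
      ≤ (H.minusVerts S).numComponents := numComponents_minusVerts_anti hle S
    _ = (H.minusVerts (S ∩ U ∪ S \ U)).numComponents := by rw [Set.inter_union_sdiff]
    _ ≤ (H.minusVerts (S ∩ U)).numComponents + (S \ U).ncard :=
        numComponents_minusVerts_union_le _ fun w hw => hdeg w hw.2
    _ ≤ (S ∩ U).ncard + (S \ U).ncard + 2 * t := by omega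
    _ = S.ncard + 2 * t := by rw [Set.ncard_inter_add_ncard_sdiff_eq_ncard]

/-! ### Branches at a vertex -/

/-- `A` is a union of connected components of `G - x`. -/
structure IsBranch (G : SimpleGraph V) (x : V) (A : Set V) : Prop where
  notMem : x ∉ A
  mem_or_eq : ∀ ⦃v w⦄, v ∈ A → G.Adj v w → w ∈ A ∨ w = x

/-- `A` and `B` are disjoint nonempty branches at `x`; they need not be connected. -/
structure IsBranchPair (G : SimpleGraph V) (x : V) (A B : Set V) : Prop where
  left : IsBranch G x A
  right : IsBranch G x B
  left_nonempty : A.Nonempty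
  right_nonempty : B.Nonempty
  disjoint : Disjoint A B

section Branches

variable {x y : V} {A B C L : Set V}

theorem IsBranch.induce (h : IsBranch G x A) (hx : x ∈ L) :
    IsBranch (G.induce L) ⟨x, hx⟩ (Subtype.val ⁻¹' A) :=
  ⟨h.notMem, fun _ _ hv hadj => (h.mem_or_eq hv hadj).imp id Subtype.ext⟩

theorem IsBranchPair.induce (h : IsBranchPair G x A B) (hx : x ∈ L) (hA : (L ∩ A).Nonempty)
    (hB : (L ∩ B).Nonempty) :
    IsBranchPair (G.induce L) ⟨x, hx⟩ (Subtype.val ⁻¹' A) (Subtype.val ⁻¹' B) :=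
  ⟨h.left.induce hx, h.right.induce hx, Subtype.preimage_coe_nonempty.2 hA,
    Subtype.preimage_coe_nonempty.2 hB, h.disjoint.preimage _⟩

theorem IsBranch.subset_of_preconnected (h : IsBranch G x A) (hL : (G.induce L).Preconnected)
    (hx : x ∉ L) (hne : (L ∩ A).Nonempty) : L ⊆ A := by
  obtain ⟨a, haL, haA⟩ := hne
  refine fun v hv => mem_of_reachable (P := (Subtype.val ⁻¹' A : Set L)) ?_
    (hL ⟨a, haL⟩ ⟨v, hv⟩) haA
  exact fun v w hadj hvA => (h.mem_or_eq hvA hadj).resolve_right fun hwx => hx (hwx ▸ w.2)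

theorem IsBranch.eq_of_subset (h : IsBranch G x A) (hA : A.Nonempty)
    (hL : (G.induce L).Preconnected) (hx : x ∉ L) (hAL : A ⊆ L) : L = A :=
  (h.subset_of_preconnected hL hx (by rwa [Set.inter_eq_right.2 hAL])).antisymm hAL

theorem IsBranch.subset_of_notMem (h : IsBranch G x A) (hL : (G.induce Lᶜ).Preconnected)
    (hx : x ∈ L) (hy : y ∉ L) (hyA : y ∉ A) : A ⊆ L := by
  by_contra hAL
  obtain ⟨v, hvA, hvL⟩ := Set.not_subset.1 hAL
  exact hyA (h.subset_of_preconnected hL (Set.notMem_compl_iff.2 hx) ⟨v, hvL, hvA⟩ hy)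

theorem IsBranch.disjoint_of_ne (hG : G.Preconnected) (hxy : x ≠ y) (hA : IsBranch G x A)
    (hC : IsBranch G y C) (hyA : y ∉ A) (hxC : x ∉ C) : Disjoint A C := by
  refine Set.disjoint_left.2 fun v hvA hvC => hA.notMem ?_
  refine (mem_of_reachable (P := A ∩ C) (fun v w hadj hv => ?_) (hG v x) ⟨hvA, hvC⟩).1
  rcases hA.mem_or_eq hv.1 hadj with hwA | rfl <;> rcases hC.mem_or_eq hv.2 hadj with hwC | rfl
  exacts [⟨hwA, hwC⟩, absurd hwA hyA, absurd hwC hxC, absurd rfl hxy]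

theorem IsBranch.compl_insert_union (hA : IsBranch G x A) (hB : IsBranch G x B) :
    IsBranch G x (insert x (A ∪ B))ᶜ := by
  refine ⟨fun hx => hx (Set.mem_insert x _), fun v w hv hadj => or_iff_not_imp_right.2 ?_⟩
  rintro hwx (rfl | hwA | hwB)
  · exact hwx rfl
  · exact hv ((hA.mem_or_eq hwA hadj.symm).symm.imp id Or.inl)
  · exact hv ((hB.mem_or_eq hwB hadj.symm).symm.imp id Or.inr)

theorem IsBranch.subset_or_subset_or_subset_compl (hA : IsBranch G x A) (hB : IsBranch G x B)
    (hL : (G.induce L).Preconnected) (hx : x ∉ L) :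
    L ⊆ A ∨ L ⊆ B ∨ L ⊆ (insert x (A ∪ B))ᶜ := by
  by_cases hLA : (L ∩ A).Nonempty
  · exact .inl (hA.subset_of_preconnected hL hx hLA)
  by_cases hLB : (L ∩ B).Nonempty
  · exact .inr (.inl (hB.subset_of_preconnected hL hx hLB))
  refine .inr (.inr fun v hv => ?_)
  rintro (rfl | hvA | hvB)
  exacts [hx hv, hLA ⟨v, hv, hvA⟩, hLB ⟨v, hv, hvB⟩]

theorem IsBranch.ncard_insert_union [Finite V] (hA : IsBranch G x A) (hB : IsBranch G x B)
    (hAB : Disjoint A B) : (insert x (A ∪ B)).ncard = A.ncard + B.ncard + 1 := by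
  have hx : x ∉ A ∪ B := not_or.2 ⟨hA.notMem, hB.notMem⟩
  rw [Set.ncard_insert_of_notMem hx, Set.ncard_union_eq hAB]

theorem IsBranchPair.ncard_insert_union [Finite V] (h : IsBranchPair G x A B) :
    (insert x (A ∪ B)).ncard = A.ncard + B.ncard + 1 :=
  h.left.ncard_insert_union h.right h.disjoint

theorem half_card_le_ncard_of_isRP [Finite V] (h : G.IsRP) (hA : IsBranch G x A)
    (hB : IsBranch G x B) :
    Nat.card V / 2 ≤ A.ncard ∨ Nat.card V / 2 ≤ B.ncard ∨
      Nat.card V / 2 ≤ (insert x (A ∪ B))ᶜ.ncard := by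
  rcases (Nat.card V / 2).eq_zero_or_pos with hzero | hpos
  · exact .inl (hzero ▸ Nat.zero_le _)
  have hpart {L : Set V} (hL : (G.induce L).IsRP) (hx : x ∉ L) (hcard : Nat.card V / 2 ≤ L.ncard) :=
    (hA.subset_or_subset_or_subset_compl hB (connected_of_isRP hL).preconnected hx).imp
      (fun hLA => hcard.trans (Set.ncard_le_ncard hLA))
      (Or.imp (fun hLB => hcard.trans (Set.ncard_le_ncard hLB))
        (fun hLR => hcard.trans (Set.ncard_le_ncard hLR)))
  obtain ⟨L, hcard, hL, hLc⟩ := exists_cut_of_isRP h hpos (by omega)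
  by_cases hx : x ∈ L
  · have := Set.ncard_add_ncard_compl L
    exact hpart hLc (Set.notMem_compl_iff.2 hx) (by omega)
  · exact hpart hL hx hcard.ge

/-- Partition the graph into parts of size `c`: branches with fewer than `c` vertices lie in the
part of `x`. -/
theorem ncard_add_ncard_lt_of_isRP [Finite V] (h : G.IsRP) (hA : IsBranch G x A)
    (hB : IsBranch G x B) (hAB : Disjoint A B) {c : ℕ} (hc : c ∣ Nat.card V)
    (hcV : c < Nat.card V) (hAc : A.ncard < c) (hBc : B.ncard < c) : A.ncard + B.ncard < c := by
  obtain ⟨k, hk⟩ := hc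
  have hk2 : 2 ≤ k := by
    by_contra! hk2
    have := Nat.mul_le_mul_left c (Nat.le_of_lt_succ hk2)
    omega
  obtain ⟨P, ⟨hdis, hunion, hcard⟩, hRP⟩ := exists_isVertexPartition_of_isRP h hk2
    (a := fun _ => c) ⟨fun _ => Nat.zero_lt_of_lt hAc, monotone_const, by simp [hk, mul_comm]⟩
  have hcover (v : V) : ∃ i, v ∈ P i := Set.mem_iUnion.1 (hunion ▸ Set.mem_univ v)
  obtain ⟨i, hi⟩ := hcover x
  have hsmall {E : Set V} (hE : IsBranch G x E) (hEc : E.ncard < c) : E ⊆ P i := by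
    intro v hv
    obtain ⟨j, hj⟩ := hcover v
    obtain rfl | hij := eq_or_ne j i
    · exact hj
    have hx : x ∉ P j := Set.disjoint_right.1 (hdis hij) hi
    have := Set.ncard_le_ncard
      (hE.subset_of_preconnected (connected_of_isRP (hRP j)).preconnected hx ⟨v, hj, hv⟩)
    exact absurd (this.trans_lt hEc) (hcard j).not_lt
  calc A.ncard + B.ncard < A.ncard + B.ncard + 1 := Nat.lt_succ_self _
    _ = (insert x (A ∪ B)).ncard := (hA.ncard_insert_union hB hAB).symm
    _ ≤ (P i).ncard := Set.ncard_le_ncard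
        (Set.insert_subset hi (Set.union_subset (hsmall hA hAc) (hsmall hB hBc)))
    _ = c := hcard i

end Branches

/-! ### Sizes of branches -/

/-- Conditions met by the sizes `p`, `q`, `r` of the parts of `G - x` when `G` is an RP graph with
`n` vertices and `G - x` is split into three branches, the first two of which are nonempty. -/
structure Admissible (n p q r : ℕ) : Prop where
  left_pos : 0 < p
  right_pos : 0 < q
  card : p + q + r + 1 = n
  half_le : n / 2 ≤ p ∨ n / 2 ≤ q ∨ n / 2 ≤ r
  left_right_lt : ∀ c, c ∣ n → c < n → p < c → q < c → p + q < c
  left_rest_lt : ∀ c, c ∣ n → c < n → p < c → r < c → p + r < c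
  right_rest_lt : ∀ c, c ∣ n → c < n → q < c → r < c → q + r < c

section Admissible

variable {n p q r : ℕ}

theorem Admissible.add_lt (h : Admissible n p q r) : p + q < n := by
  have := h.card
  omega

theorem Admissible.add_eq_three (h : Admissible 4 p q r) : p + q = 3 := by
  obtain ⟨hp, hq, hcard, hhalf, -, -, -⟩ := h
  omega

theorem Admissible.add_eq_five (h : Admissible 6 p q r) : p + q = 5 := by
  obtain ⟨hp, hq, hcard, hhalf, hpq, hpr, hqr⟩ := h
  have := hpq 2 (by norm_num) (by norm_num)
  have := hpr 2 (by norm_num) (by norm_num)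
  have := hqr 2 (by norm_num) (by norm_num)
  omega

theorem Admissible.add_ne_three (h : Admissible 9 p q r) : p + q ≠ 3 := by
  obtain ⟨hp, hq, hcard, -, hpq, -, -⟩ := h
  have := hpq 3 (by norm_num) (by norm_num)
  omega

theorem Admissible.eq_one_or_eq_one (h : Admissible 9 p q r) (hpq : p + q = 5) :
    p = 1 ∨ q = 1 := by
  obtain ⟨hp, hq, hcard, hhalf, -, -, -⟩ := h
  omega

/-- Here `a`, `b` are the sizes of two branches (legs) at one vertex, and `c`, `d` those at
another one. -/
theorem exists_size_not_admissible {n a b c d : ℕ} (ha : 0 < a) (hb : 0 < b) (hc : 0 < c)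
    (hd : 0 < d) (hn : a + b + c + d + 2 ≤ n) :
    ∃ l, 0 < l ∧ l < n ∧ (l ≠ a ∧ l ≠ b ∧ l ≠ c ∧ l ≠ d) ∧
      (∀ r, ¬Admissible l a b r) ∧ ∀ r, ¬Admissible l c d r := by
  by_contra! hno
  have hcut {P : ℕ → ℕ → Prop} (l : ℕ) (hl : 0 < l) (hln : l < n)
      (hP : ∀ {p q r}, Admissible l p q r → P p q) :
      (a = l ∨ b = l ∨ c = l ∨ d = l) ∨ P a b ∨ P c d := by
    by_contra! hne
    obtain ⟨r, hr⟩ := hno l hl hln (by omega) fun r hr => hne.2.1 (hP hr)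
    exact hne.2.2 (hP hr)
  have leg_one : a = 1 ∨ b = 1 ∨ c = 1 ∨ d = 1 := by
    have := hcut 1 (by omega) (by omega) Admissible.add_lt
    omega
  have leg_two : a = 2 ∨ b = 2 ∨ c = 2 ∨ d = 2 := by
    have := hcut 2 (by omega) (by omega) Admissible.add_lt
    omega
  have four := hcut 4 (by omega) (by omega) Admissible.add_eq_three
  have six := hcut 6 (by omega) (by omega) Admissible.add_eq_five
  -- Next to `{1, 1}` and `2`, the fourth leg must be 1 or 4 by `four`, but 3 or 6 by `six`.
  have not_pair_one_one : a + b ≠ 2 ∧ c + d ≠ 2 := by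
    rcases leg_two with h | h | h | h <;> omega
  have leg_three : a = 3 ∨ b = 3 ∨ c = 3 ∨ d = 3 := by
    have := hcut 3 (by omega) (by omega) Admissible.add_lt
    omega
  -- Legs 1, 2, 3, 4 sum to 10, so `six` splits them into pairs of sum 5, against `five`.
  have pair_one_two : a + b = 3 ∨ c + d = 3 := by
    refine four.resolve_left fun leg_four => ?_
    have five := hcut 5 (by omega) (by omega) Admissible.add_lt
    rcases leg_one with h | h | h | h <;> rcases leg_two with h' | h' | h' | h' <;> omega
  have nine (hlt : 9 < n) :=
    hcut (P := fun p q => p + q < 9 ∧ p + q ≠ 3 ∧ (p + q = 5 → p = 1 ∨ q = 1)) 9 (by omega) hlt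
      fun h => ⟨h.add_lt, h.add_ne_three, h.eq_one_or_eq_one⟩
  -- The pairs are `{1, 2}` and `{3, e}`: `six` forces `e` to be 2 or 6, and `nine` excludes both.
  rcases pair_one_two with h | h <;> rcases leg_three with h' | h' | h' | h' <;> omega

end Admissible

theorem exists_admissible_of_isRP [Finite V] (h : G.IsRP) {x : V} {A B : Set V}
    (hAB : IsBranchPair G x A B) : ∃ r, Admissible (Nat.card V) A.ncard B.ncard r := by
  have hR := hAB.left.compl_insert_union hAB.right
  have hdis : Disjoint (A ∪ B) (insert x (A ∪ B))ᶜ :=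
    Set.disjoint_compl_right_iff_subset.2 (Set.subset_insert x _)
  have hcard := Set.ncard_add_ncard_compl (insert x (A ∪ B))
  rw [hAB.ncard_insert_union] at hcard
  exact ⟨(insert x (A ∪ B))ᶜ.ncard, (Set.ncard_pos).2 hAB.left_nonempty,
    (Set.ncard_pos).2 hAB.right_nonempty, by omega,
    half_card_le_ncard_of_isRP h hAB.left hAB.right,
    fun _ => ncard_add_ncard_lt_of_isRP h hAB.left hAB.right hAB.disjoint,
    fun _ => ncard_add_ncard_lt_of_isRP h hAB.left hR (Set.disjoint_union_left.1 hdis).1,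
    fun _ => ncard_add_ncard_lt_of_isRP h hAB.right hR (Set.disjoint_union_left.1 hdis).2⟩

theorem exists_admissible_of_subset [Finite V] {L : Set V} (hL : (G.induce L).IsRP) {x : V}
    (hx : x ∈ L) {A B : Set V} (hAB : IsBranchPair G x A B) (hA : A ⊆ L) (hB : B ⊆ L) :
    ∃ r, Admissible L.ncard A.ncard B.ncard r := by
  have hinterA := Set.inter_eq_right.2 hA
  have hinterB := Set.inter_eq_right.2 hB
  have := exists_admissible_of_isRP hL (hAB.induce hx (hinterA.symm ▸ hAB.left_nonempty)
    (hinterB.symm ▸ hAB.right_nonempty))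
  rwa [ncard_preimage_val, ncard_preimage_val, hinterA, hinterB] at this

/-! ### Pairs of forks -/

/-- `A`, `B` are disjoint branches at `x` avoiding `y`, and `C`, `D` are disjoint branches at `y`
avoiding `x`. In a tree such sets exist whenever `x ≠ y` have degree at least three. -/
structure IsForkPair (G : SimpleGraph V) (x y : V) (A B C D : Set V) : Prop where
  ne : x ≠ y
  left : IsBranchPair G x A B
  right : IsBranchPair G y C D
  notMem_A : y ∉ A
  notMem_B : y ∉ B
  notMem_C : x ∉ C
  notMem_D : x ∉ D

/-- `G` has two distinct vertices, each with two branches avoiding the other. -/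
def HasForkPair (G : SimpleGraph V) : Prop :=
  ∃ x y A B C D, IsForkPair G x y A B C D

namespace IsForkPair

variable {x y : V} {A B C D L : Set V}

theorem disjoint (h : IsForkPair G x y A B C D) (hG : G.Preconnected) :
    Disjoint (A ∪ B) (C ∪ D) := by
  have hdis {E F : Set V} (hE : IsBranch G x E) (hF : IsBranch G y F) (hyE : y ∉ E) (hxF : x ∉ F) :
      Disjoint E F := hE.disjoint_of_ne hG h.ne hF hyE hxF
  rw [Set.disjoint_union_left, Set.disjoint_union_right, Set.disjoint_union_right]
  exact ⟨⟨hdis h.left.left h.right.left h.notMem_A h.notMem_C,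
      hdis h.left.left h.right.right h.notMem_A h.notMem_D⟩,
    hdis h.left.right h.right.left h.notMem_B h.notMem_C,
    hdis h.left.right h.right.right h.notMem_B h.notMem_D⟩

theorem add_le_card [Finite V] (h : IsForkPair G x y A B C D) (hG : G.Preconnected) :
    A.ncard + B.ncard + C.ncard + D.ncard + 2 ≤ Nat.card V := by
  have hdis : Disjoint (insert x (A ∪ B)) (insert y (C ∪ D)) := by
    rw [Set.disjoint_insert_left, Set.disjoint_insert_right]
    refine ⟨?_, not_or.2 ⟨h.notMem_A, h.notMem_B⟩, h.disjoint hG⟩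
    rintro (hxy | hxC | hxD)
    exacts [h.ne hxy, h.notMem_C hxC, h.notMem_D hxD]
  have := Set.ncard_union_eq hdis
  rw [h.left.ncard_insert_union, h.right.ncard_insert_union] at this
  have := Set.ncard_le_card (insert x (A ∪ B) ∪ insert y (C ∪ D))
  omega

theorem eq_of_not_hasForkPair (h : IsForkPair G x y A B C D) (hL : (G.induce L).Preconnected)
    (hx : x ∉ L) (hy : y ∉ L) (hLc : ¬HasForkPair (G.induce Lᶜ)) :
    L = A ∨ L = B ∨ L = C ∨ L = D := by
  by_contra! hne
  obtain ⟨hA, hB, hC, hD⟩ := hne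
  have hmeet {z : V} {E : Set V} (hE : IsBranch G z E) (hEne : E.Nonempty) (hz : z ∉ L)
      (hLE : L ≠ E) : (Lᶜ ∩ E).Nonempty := by
    obtain ⟨v, hvE, hvL⟩ := Set.not_subset.1 (mt (hE.eq_of_subset hEne hL hz) hLE)
    exact ⟨v, hvL, hvE⟩
  exact hLc ⟨⟨x, hx⟩, ⟨y, hy⟩, _, _, _, _, Subtype.coe_ne_coe.1 h.ne,
    h.left.induce hx (hmeet h.left.left h.left.left_nonempty hx hA)
      (hmeet h.left.right h.left.right_nonempty hx hB),
    h.right.induce hy (hmeet h.right.left h.right.left_nonempty hy hC)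
      (hmeet h.right.right h.right.right_nonempty hy hD),
    h.notMem_A, h.notMem_B, h.notMem_C, h.notMem_D⟩

theorem subset_or_subset (h : IsForkPair G x y A B C D) (hG : G.Preconnected)
    (hLc : (G.induce Lᶜ).Preconnected) (hx : x ∈ L) (hy : y ∈ L)
    (hL : ¬HasForkPair (G.induce L)) : A ∪ B ⊆ L ∨ C ∪ D ⊆ L := by
  have hsub {E F : Set V} (hE : Lᶜ ⊆ E) (hEF : Disjoint E F) : F ⊆ L :=
    Set.disjoint_compl_left_iff_subset.1 (hEF.mono_left hE)
  rcases h.eq_of_not_hasForkPair hLc (Set.notMem_compl_iff.2 hx) (Set.notMem_compl_iff.2 hy)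
    (by rwa [compl_compl]) with hA | hB | hC | hD
  · exact .inr (hsub (hA.le.trans Set.subset_union_left) (h.disjoint hG))
  · exact .inr (hsub (hB.le.trans Set.subset_union_right) (h.disjoint hG))
  · exact .inl (hsub (hC.le.trans Set.subset_union_left) (h.disjoint hG).symm)
  · exact .inl (hsub (hD.le.trans Set.subset_union_right) (h.disjoint hG).symm)

theorem eq_or_exists_admissible [Finite V] (h : IsForkPair G x y A B C D) (hG : G.Preconnected)
    (hL : (G.induce L).IsRP) (hLc : (G.induce Lᶜ).IsRP) (hLfork : ¬HasForkPair (G.induce L))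
    (hLcfork : ¬HasForkPair (G.induce Lᶜ)) :
    (L = A ∨ L = B ∨ L = C ∨ L = D) ∨ (∃ r, Admissible L.ncard A.ncard B.ncard r) ∨
      ∃ r, Admissible L.ncard C.ncard D.ncard r := by
  have hLconn := (connected_of_isRP hL).preconnected
  have hLcconn := (connected_of_isRP hLc).preconnected
  have hleft (hx : x ∈ L) (hAB : A ∪ B ⊆ L) : ∃ r, Admissible L.ncard A.ncard B.ncard r :=
    exists_admissible_of_subset hL hx h.left (Set.union_subset_iff.1 hAB).1
      (Set.union_subset_iff.1 hAB).2
  have hright (hy : y ∈ L) (hCD : C ∪ D ⊆ L) : ∃ r, Admissible L.ncard C.ncard D.ncard r :=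
    exists_admissible_of_subset hL hy h.right (Set.union_subset_iff.1 hCD).1
      (Set.union_subset_iff.1 hCD).2
  by_cases hx : x ∈ L <;> by_cases hy : y ∈ L
  · exact .inr ((h.subset_or_subset hG hLcconn hx hy hLfork).imp (hleft hx) (hright hy))
  · exact .inr (.inl (hleft hx (Set.union_subset
      (h.left.left.subset_of_notMem hLcconn hx hy h.notMem_A)
      (h.left.right.subset_of_notMem hLcconn hx hy h.notMem_B))))
  · exact .inr (.inr (hright hy (Set.union_subset
      (h.right.left.subset_of_notMem hLcconn hy hx h.notMem_C)
      (h.right.right.subset_of_notMem hLcconn hy hx h.notMem_D))))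
  · exact .inl (h.eq_of_not_hasForkPair hLconn hx hy hLcfork)

end IsForkPair

theorem not_hasForkPair_of_isRP [Finite V] (h : G.IsRP) : ¬HasForkPair G := by
  induction hn : Nat.card V using Nat.strong_induction_on generalizing V with | _ n ih
  subst hn
  rintro ⟨x, y, A, B, C, D, hF⟩
  have hG := (connected_of_isRP h).preconnected
  obtain ⟨l, hl, hlV, hne, hAB, hCD⟩ := exists_size_not_admissible
    ((Set.ncard_pos).2 hF.left.left_nonempty) ((Set.ncard_pos).2 hF.left.right_nonempty)
    ((Set.ncard_pos).2 hF.right.left_nonempty) ((Set.ncard_pos).2 hF.right.right_nonempty)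
    (hF.add_le_card hG)
  obtain ⟨L, rfl, hL, hLc⟩ := exists_cut_of_isRP h hl hlV
  have hcard := Set.ncard_add_ncard_compl L
  rcases hF.eq_or_exists_admissible hG hL hLc (ih _ hlV hL rfl)
    (ih Lᶜ.ncard (by omega) hLc rfl) with hleg | ⟨r, hr⟩ | ⟨r, hr⟩
  · rcases hleg with rfl | rfl | rfl | rfl <;> simp at hne
  · exact hAB r hr
  · exact hCD r hr

/-! ### Trees -/

/-- The component of `p` in `G - x`, for `p ≠ x`. -/
def branchAt (G : SimpleGraph V) (x p : V) : Set V :=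
  {v | (G.deleteIncidenceSet x).Reachable p v}

theorem isBranch_branchAt {x p : V} (hp : p ≠ x) : IsBranch G x (branchAt G x p) := by
  have hne {v : V} (hv : v ∈ branchAt G x p) : v ≠ x :=
    mem_of_reachable (P := {x}ᶜ) (fun _ _ hadj _ => (deleteIncidenceSet_adj.1 hadj).2.2) hv hp
  refine ⟨fun hx => hne hx rfl, fun v w hv hadj => or_iff_not_imp_right.2 fun hw => ?_⟩
  exact Reachable.trans hv (Adj.reachable (deleteIncidenceSet_adj.2 ⟨hadj, hne hv, hw⟩))

theorem not_reachable_deleteIncidenceSet_of_isAcyclic (hG : G.IsAcyclic) {x p q : V}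
    (hp : G.Adj x p) (hq : G.Adj x q) (hpq : p ≠ q) :
    ¬(G.deleteIncidenceSet x).Reachable p q := by
  intro hreach
  refine isBridge_iff.1 (isAcyclic_iff_forall_adj_isBridge.1 hG hp) ?_
  have hxq : (G.deleteEdges {s(x, p)}).Adj x q := by
    simp [deleteEdges_adj, hq, hpq.symm, hp.ne]
  have hle : G.deleteIncidenceSet x ≤ G.deleteEdges {s(x, p)} :=
    deleteEdges_anti (Set.singleton_subset_iff.2 ⟨hp, Sym2.mem_mk_left x p⟩)
  exact hxq.reachable.trans (hreach.mono hle).symm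

theorem isBranchPair_branchAt_of_isAcyclic (hG : G.IsAcyclic) {x p q : V} (hp : G.Adj x p)
    (hq : G.Adj x q) (hpq : p ≠ q) : IsBranchPair G x (branchAt G x p) (branchAt G x q) :=
  ⟨isBranch_branchAt hp.ne', isBranch_branchAt hq.ne', ⟨p, Reachable.rfl⟩, ⟨q, Reachable.rfl⟩,
    Set.disjoint_left.2 fun _ hvp hvq =>
      not_reachable_deleteIncidenceSet_of_isAcyclic hG hp hq hpq (hvp.trans hvq.symm)⟩

theorem exists_isBranchPair_of_two_lt [Finite V] (hG : G.IsAcyclic) {x : V}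
    (hx : 2 < (G.neighborSet x).ncard) (y : V) :
    ∃ A B, IsBranchPair G x A B ∧ y ∉ A ∧ y ∉ B := by
  obtain ⟨p, hp, q, hq, r, hr, hpq, hpr, hqr⟩ := (Set.two_lt_ncard).1 hx
  have hpq := isBranchPair_branchAt_of_isAcyclic hG hp hq hpq
  have hpr := isBranchPair_branchAt_of_isAcyclic hG hp hr hpr
  have hqr := isBranchPair_branchAt_of_isAcyclic hG hq hr hqr
  by_cases hyp : y ∈ branchAt G x p
  · exact ⟨_, _, hqr, Set.disjoint_left.1 hpq.disjoint hyp, Set.disjoint_left.1 hpr.disjoint hyp⟩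
  by_cases hyq : y ∈ branchAt G x q
  · exact ⟨_, _, hpr, hyp, Set.disjoint_left.1 hqr.disjoint hyq⟩
  · exact ⟨_, _, hpq, hyp, hyq⟩

theorem ncard_two_lt_ncard_neighborSet_le_one [Finite V] (hG : G.IsAcyclic) (h : G.IsRP) :
    {x | 2 < (G.neighborSet x).ncard}.ncard ≤ 1 := by
  refine (Set.ncard_le_one).2 fun x hx y hy => ?_
  by_contra hxy
  obtain ⟨A, B, hAB, hyA, hyB⟩ := exists_isBranchPair_of_two_lt hG hx y
  obtain ⟨C, D, hCD, hxC, hxD⟩ := exists_isBranchPair_of_two_lt hG hy x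
  exact not_hasForkPair_of_isRP h ⟨x, y, A, B, C, D, hxy, hAB, hCD, hyA, hyB, hxC, hxD⟩

/-! ### Balloons -/

theorem ncard_pair_le_two (v w : V) : ({v, w} : Set V).ncard ≤ 2 :=
  (Set.ncard_insert_le v {w}).trans (by rw [Set.ncard_singleton])

theorem ncard_neighborSet_balloon_le_two {k : ℕ} (b : Fin k → ℕ) (p : Σ i : Fin k, Fin (b i)) :
    ((balloon b).neighborSet (Sum.inr p)).ncard ≤ 2 := by
  obtain ⟨i, j⟩ := p
  let prev : Bool ⊕ (Σ i : Fin k, Fin (b i)) :=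
    if (j : ℕ) = 0 then Sum.inl false else Sum.inr ⟨i, ⟨j - 1, by omega⟩⟩
  let next : Bool ⊕ (Σ i : Fin k, Fin (b i)) :=
    if h : (j : ℕ) + 1 = b i then Sum.inl true else Sum.inr ⟨i, ⟨j + 1, by omega⟩⟩
  suffices hsub : (balloon b).neighborSet (Sum.inr ⟨i, j⟩) ⊆ {prev, next} from
    (Set.ncard_le_ncard hsub).trans (ncard_pair_le_two _ _)
  intro w hw
  simp only [mem_neighborSet, balloon, fromRel_adj] at hw
  rcases w with (_ | _) | ⟨i', j'⟩
  · exact .inl (by simp_all [prev])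
  · exact .inr (by simp_all [next])
  · rcases hw.2 with ⟨rfl, hj⟩ | ⟨rfl, hj⟩
    · have hne : (j : ℕ) + 1 ≠ b i := hj.trans_ne j'.2.ne
      refine .inr ?_
      simp only [Set.mem_singleton_iff, next, dif_neg hne, hj]
    · have hne : (j : ℕ) ≠ 0 := hj.symm.trans_ne (Nat.succ_ne_zero _)
      refine .inl ?_
      simp only [prev, if_neg hne]
      congr 2
      exact Fin.ext (Nat.eq_sub_of_add_eq hj)

theorem exists_ncard_neighborSet_le_two_of_isBalloon [Finite V] (h : H.IsBalloon) :
    ∃ U : Set V, U.ncard ≤ 2 ∧ ∀ w ∉ U, (H.neighborSet w).ncard ≤ 2 := by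
  obtain ⟨k, b, -, ⟨φ⟩⟩ := h
  refine ⟨{φ.symm (Sum.inl false), φ.symm (Sum.inl true)}, ncard_pair_le_two _ _, fun w hw => ?_⟩
  have hcard : (H.neighborSet w).ncard = ((balloon b).neighborSet (φ w)).ncard :=
    Nat.card_congr (φ.mapNeighborSet w)
  rcases hp : φ w with (_ | _) | p
  · exact absurd (.inl (φ.toEquiv.eq_symm_apply.2 hp)) hw
  · exact absurd (.inr (φ.toEquiv.eq_symm_apply.2 hp)) hw
  · rw [hcard, hp]
    exact ncard_neighborSet_balloon_le_two b p

end RPGraph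

theorem mainTheorem8 {V : Type*} [Finite V] (G : SimpleGraph V) :
    ((∃ T : SimpleGraph V, T ≤ G ∧ T.IsTree ∧ T.IsRP) →
      ∀ S : Set V, (G.minusVerts S).numComponents ≤ S.ncard + 2) ∧
    ((∃ B : SimpleGraph V, B ≤ G ∧ B.IsBalloon ∧ B.IsRP) →
      ∀ S : Set V, (G.minusVerts S).numComponents ≤ S.ncard + 4) := by
  refine ⟨fun ⟨T, hle, hT, hRP⟩ S => ?_, fun ⟨B, hle, hB, hRP⟩ S => ?_⟩
  · exact RPGraph.numComponents_minusVerts_le_of_isRP hRP hle le_rfl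
      (RPGraph.ncard_two_lt_ncard_neighborSet_le_one hT.isAcyclic hRP) (fun _ hw => not_lt.1 hw) S
  · obtain ⟨U, hU, hdeg⟩ := RPGraph.exists_ncard_neighborSet_le_two_of_isBalloon hB
    exact RPGraph.numComponents_minusVerts_le_of_isRP hRP hle one_le_two hU hdeg S
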